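/- Let $\alpha(s)=(x(s),y(s))$ be a smooth closed plane curve of length $\ell$ (not necessarily simple), parametrized by arc length, let $\omega,a,\Lambda_0\in\mathbb R$, $h>0$, and let $\Sigma$ be the immersed annulus $$\phi(s,t)=\bigl(x(s)\cos\omega t+y(s)\sin\omega t,\;-x(s)\sin\omega t+y(s)\cos\omega t,\;t\bigr),\qquad s\in\mathbb R/\ell\mathbb Z,\quad t\in[-h/2,h/2],$$ denoted $\alpha\times[-h/2,h/2]$, with unit normal $\nu=\phi_s\times\phi_t/|\phi_s\times\phi_t|$ and mean curvature $H$ (half the trace of the second fundamental form with respect to $\nu$; it depends only on $s$). Put $R^2=x_1^2+x_2^2$ and, for an oriented immersed surface $S\subset\mathbb R^3$ with unit normal $\nu$, $$\mathcal V(S)=\int_S \tfrac12(x_1,x_2,0)\cdot\nu\,dS,\qquad \mathcal E_{a,\Lambda_0}(S)=\mathrm{Area}(S)-\tfrac a2\int_S\tfrac{R^2}{4}(x_1,x_2,0)\cdot\nu\,dS+\Lambda_0\,\mathcal V(S).$$ Assume that the helicoidal surface is in equilibrium, that is, $2H=\Lambda_0-\tfrac a2R^2$. Call $\Sigma$ stable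 (for fixed boundary and fixed volume) if $\frac{d^2}{d\varepsilon^2}\big|_{\varepsilon=0}\mathcal E_{a,\Lambda_0}(X_\varepsilon)\ge 0$ for every smooth variation $X_\varepsilon$ of $\Sigma$ which fixes $\partial\Sigma$ and satisfies $\int_\Sigma\psi\,d\Sigma=0$, where $\psi=\partial_\varepsilon X_\varepsilon|_{\varepsilon=0}\cdot\nu$. Write $\xi_1=xx'+yy'$, and let $\mathcal A=\frac12\oint_\alpha(x\,dy-y\,dx)$ be the algebraic area enclosed by $\alpha$. If $\Sigma$ is stable, then $$\frac{2\pi^2}{h^2}\int_\alpha\frac{ds}{\sqrt{1+\omega^2\xi_1^2}}\;\ge\;\int_\alpha 2H^2\sqrt{1+\omega^2\xi_1^2}\,ds+a\,\mathcal A .$$ Moreover, this inequality is equivalent to $$\frac{2\pi^2}{h}\int_\alpha\frac{ds}{\sqrt{1+\omega^2\xi_1^2}}\;\ge\;\int_{\alpha\times[-h/2,h/2]}2H^2\,d\Sigma+a\,\mathcal V(\alpha\times[-h/2,h/2]).$$ -/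

import Mathlib

open scoped Matrix

noncomputable section

namespace HelicoidalDrop

/-! Parametrized surfaces `X : (s, t) ↦ X s t` in `ℝ³`. Vectors are elements of `Fin 3 → ℝ`; lengths
and angles are always taken with the dot product `⬝ᵥ`. -/

/-- The partial derivative `X_s`. -/
def dS (X : ℝ → ℝ → Fin 3 → ℝ) : ℝ → ℝ → Fin 3 → ℝ :=
  fun s t => deriv (fun u => X u t) s

/-- The partial derivative `X_t`. -/
def dT (X : ℝ → ℝ → Fin 3 → ℝ) : ℝ → ℝ → Fin 3 → ℝ :=
  fun s t => deriv (fun u => X s u) t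

/-- The area density: `dΣ = |X_s × X_t| ds dt`. -/
def areaDensity (X : ℝ → ℝ → Fin 3 → ℝ) (s t : ℝ) : ℝ :=
  √((dS X s t ⨯₃ dT X s t) ⬝ᵥ (dS X s t ⨯₃ dT X s t))

/-- The unit normal `ν = X_s × X_t / |X_s × X_t|`. -/
def unitNormal (X : ℝ → ℝ → Fin 3 → ℝ) (s t : ℝ) : Fin 3 → ℝ :=
  (areaDensity X s t)⁻¹ • (dS X s t ⨯₃ dT X s t)

/-- The mean curvature `H = (e G - 2 f F + g E) / (2 (E G - F²))` with respect to `ν`, where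
`E, F, G` and `e, f, g` are the coefficients of the first and the second fundamental form. -/
def meanCurvature (X : ℝ → ℝ → Fin 3 → ℝ) (s t : ℝ) : ℝ :=
  let E := dS X s t ⬝ᵥ dS X s t
  let F := dS X s t ⬝ᵥ dT X s t
  let G := dT X s t ⬝ᵥ dT X s t
  let e := dS (dS X) s t ⬝ᵥ unitNormal X s t
  let f := dS (dT X) s t ⬝ᵥ unitNormal X s t
  let g := dT (dT X) s t ⬝ᵥ unitNormal X s t
  (e * G - 2 * f * F + g * E) / (2 * (E * G - F ^ 2))

/-- The squared distance `R²` to the vertical axis. -/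
def axisDistSq (p : Fin 3 → ℝ) : ℝ := p 0 ^ 2 + p 1 ^ 2

/-- The vector field `W₀ = (1/2)(x₁, x₂, 0)`, of divergence `1`. -/
def fieldW₀ (p : Fin 3 → ℝ) : Fin 3 → ℝ := ![p 0 / 2, p 1 / 2, 0]

/-- The vector field `W = (R²/4)(x₁, x₂, 0)`, of divergence `R²`. -/
def fieldW (p : Fin 3 → ℝ) : Fin 3 → ℝ :=
  ![axisDistSq p / 4 * p 0, axisDistSq p / 4 * p 1, 0]

/-- `∫_Σ u dΣ` over the piece `0 ≤ s ≤ ℓ`, `-h/2 ≤ t ≤ h/2` of the surface `X`. -/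
def surfaceIntegral (ℓ h : ℝ) (X : ℝ → ℝ → Fin 3 → ℝ) (u : ℝ → ℝ → ℝ) : ℝ :=
  ∫ s in (0 : ℝ)..ℓ, ∫ t in (-(h / 2))..(h / 2), u s t * areaDensity X s t

/-- The surface area of the piece. -/
def surfaceArea (ℓ h : ℝ) (X : ℝ → ℝ → Fin 3 → ℝ) : ℝ :=
  surfaceIntegral ℓ h X fun _ _ => 1

/-- The (algebraic) volume `∫_Σ W₀ · ν dΣ`. -/
def volume (ℓ h : ℝ) (X : ℝ → ℝ → Fin 3 → ℝ) : ℝ :=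
  surfaceIntegral ℓ h X fun s t => fieldW₀ (X s t) ⬝ᵥ unitNormal X s t

/-- The (algebraic) moment of inertia `∫_U R² dv := ∫_Σ W · ν dΣ`. -/
def inertia (ℓ h : ℝ) (X : ℝ → ℝ → Fin 3 → ℝ) : ℝ :=
  surfaceIntegral ℓ h X fun s t => fieldW (X s t) ⬝ᵥ unitNormal X s t

/-- The energy: surface area `- (a/2) ∫_U R² dv + Λ₀ ·` volume. -/
def energy (a Λ₀ ℓ h : ℝ) (X : ℝ → ℝ → Fin 3 → ℝ) : ℝ :=
  surfaceArea ℓ h X - a / 2 * inertia ℓ h X + Λ₀ * volume ℓ h X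

/-- The equilibrium equation `2H = Λ₀ - (a/2) R²`. -/
def IsEquilibrium (a Λ₀ : ℝ) (X : ℝ → ℝ → Fin 3 → ℝ) : Prop :=
  ∀ s t, 2 * meanCurvature X s t = Λ₀ - a / 2 * axisDistSq (X s t)

/-- `Y ε` is a smooth variation, with fixed boundary, of the annular piece of the surface `X` given
by `s ∈ ℝ/ℓℤ`, `t ∈ [-h/2, h/2]`. -/
structure IsVariation (ℓ h : ℝ) (X : ℝ → ℝ → Fin 3 → ℝ)
    (Y : ℝ → ℝ → ℝ → Fin 3 → ℝ) : Prop where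
  smooth : ContDiff ℝ (⊤ : ℕ∞) fun p : ℝ × ℝ × ℝ => Y p.1 p.2.1 p.2.2
  periodic : ∀ ε s t, Y ε (s + ℓ) t = Y ε s t
  start : ∀ s, ∀ t ∈ Set.Icc (-(h / 2)) (h / 2), Y 0 s t = X s t
  fixed_bot : ∀ ε s, Y ε s (-(h / 2)) = X s (-(h / 2))
  fixed_top : ∀ ε s, Y ε s (h / 2) = X s (h / 2)

/-- The normal component `ψ = δX · ν` of a variation, where `δX = ∂Y/∂ε` at `ε = 0`. -/
def normalComponent (X : ℝ → ℝ → Fin 3 → ℝ) (Y : ℝ → ℝ → ℝ → Fin 3 → ℝ) (s t : ℝ) : ℝ :=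
  deriv (fun ε => Y ε s t) 0 ⬝ᵥ unitNormal X s t

/-- Stability of the annular piece `s ∈ ℝ/ℓℤ`, `t ∈ [-h/2, h/2]` of `X`, for fixed boundary and fixed
volume: the second variation of the energy is nonnegative for every variation which fixes the
boundary and satisfies `∫_Σ ψ dΣ = 0`. -/
def IsStable (a Λ₀ ℓ h : ℝ) (X : ℝ → ℝ → Fin 3 → ℝ) : Prop :=
  ∀ Y : ℝ → ℝ → ℝ → Fin 3 → ℝ, IsVariation ℓ h X Y →
    surfaceIntegral ℓ h X (normalComponent X Y) = 0 →
    0 ≤ iteratedDeriv 2 (fun ε => energy a Λ₀ ℓ h (Y ε)) 0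

/-- `α = (x, y)` is a smooth closed plane curve of length `ℓ`, parametrized by arc length. -/
structure IsClosedCurve (x y : ℝ → ℝ) (ℓ : ℝ) : Prop where
  length_pos : 0 < ℓ
  smooth_x : ContDiff ℝ (⊤ : ℕ∞) x
  smooth_y : ContDiff ℝ (⊤ : ℕ∞) y
  periodic_x : ∀ s, x (s + ℓ) = x s
  periodic_y : ∀ s, y (s + ℓ) = y s
  arc_length : ∀ s, deriv x s ^ 2 + deriv y s ^ 2 = 1

/-- The helicoidal immersion with profile curve `(x, y)`. -/
def helicoidal (ω : ℝ) (x y : ℝ → ℝ) : ℝ → ℝ → Fin 3 → ℝ := fun s t =>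
  ![x s * Real.cos (ω * t) + y s * Real.sin (ω * t),
    -x s * Real.sin (ω * t) + y s * Real.cos (ω * t),
    t]

/-- The TreadmillSled coordinate `ξ₁ = x cos θ + y sin θ`, where `(x', y') = (cos θ, sin θ)`. -/
def xi₁ (x y : ℝ → ℝ) (s : ℝ) : ℝ := x s * deriv x s + y s * deriv y s

/-- The (algebraic) area `(1/2) ∮ (x dy - y dx)` enclosed by the closed curve `(x, y)`. -/
def enclosedArea (x y : ℝ → ℝ) (ℓ : ℝ) : ℝ :=
  1 / 2 * ∫ s in (0 : ℝ)..ℓ, (x s * deriv y s - y s * deriv x s)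

/-- The bound on the height in terms of the profile curve and the area enclosed by it. Since `H`
does not depend on `t`, it is evaluated on the slice `t = 0`. -/
def AreaBound (a ω ℓ h : ℝ) (x y : ℝ → ℝ) : Prop :=
  2 * Real.pi ^ 2 / h ^ 2 * (∫ s in (0 : ℝ)..ℓ, 1 / √(1 + ω ^ 2 * xi₁ x y s ^ 2)) ≥
    (∫ s in (0 : ℝ)..ℓ,
      2 * meanCurvature (helicoidal ω x y) s 0 ^ 2 * √(1 + ω ^ 2 * xi₁ x y s ^ 2)) +
    a * enclosedArea x y ℓ

/-- The same bound in terms of the surface and the volume. -/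
def VolumeBound (a ω ℓ h : ℝ) (x y : ℝ → ℝ) : Prop :=
  2 * Real.pi ^ 2 / h * (∫ s in (0 : ℝ)..ℓ, 1 / √(1 + ω ^ 2 * xi₁ x y s ^ 2)) ≥
    surfaceIntegral ℓ h (helicoidal ω x y)
      (fun s t => 2 * meanCurvature (helicoidal ω x y) s t ^ 2) +
    a * volume ℓ h (helicoidal ω x y)

end HelicoidalDrop

end

open HelicoidalDrop

/-! Displace the annulus horizontally along the normal of the profile curve, with speed `W(s) g(t)`,
where `W = √(1 + ω² ξ₁²)` is the area density; the normal component is then `g(t)`. Writing `κ` for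
the curvature of the profile curve, the second variation of the energy is
`(∫ ds / W) (∫ g'²) + (∫ Q ds) (∫ g²)` with an explicit `Q`, the mixed terms being multiples of
`g g' = (g² / 2)'`. In terms of the moving frame of the profile curve, where `ξ₁' = 1 - κ ξ₂` and
`ξ₂' = κ ξ₁`, the mean curvature has the divergence form `2H = (ω² ξ₁ ξ₂ / W)' - κ W` and the
equilibrium condition gives `(2H)' = -a ξ₁`. From these, `Q + 4 H² W + a ξ₂` is the derivative of
`ω² ξ₁ (W - 1 / W) + 2 ω² ξ₁ ξ₂ H + (a / 4) ξ₁ ξ₂ W²`, which is periodic on a closed curve, so that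
`∫ Q ds = -2 (∫ 2 H² W ds + a 𝒜)` because `∫ ξ₂ ds = 2 𝒜`.
The inequality follows on taking `g(t) = sin (2 π t / h)`. -/

noncomputable section

namespace HelicoidalDrop

open Set Filter Topology MeasureTheory

section ParametricIntegral

variable {P E : Type*} [NormedAddCommGroup P] [NormedSpace ℝ P] [NormedAddCommGroup E]
  [NormedSpace ℝ E] {F : ℝ → P → E} {ε₀ : ℝ}

theorem contDiffAt_uncurry_deriv {m n : WithTop ℕ∞} {ε : ℝ} {p : P}
    (hF : ContDiffAt ℝ n (Function.uncurry F) (ε, p)) (hmn : m + 1 ≤ n) :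
    ContDiffAt ℝ m (Function.uncurry fun ε p => deriv (fun e => F e p) ε) (ε, p) :=
  ((ContDiffAt.fderiv (f := fun (z : ℝ × P) e => F e z.2) (g := Prod.fst)
    (hF.comp ((ε, p), ε) (contDiffAt_snd.prodMk (contDiffAt_fst.snd))) contDiffAt_fst
    hmn).clm_apply contDiffAt_const)

theorem contDiffAt_uncurry_iteratedDeriv {n : ℕ} {ε : ℝ} {p : P}
    (hF : ContDiffAt ℝ n (Function.uncurry F) (ε, p)) :
    ContDiffAt ℝ 0 (Function.uncurry fun ε p => iteratedDeriv n (fun e => F e p) ε) (ε, p) := by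
  induction n generalizing F with
  | zero => simpa using hF
  | succ n ih =>
    simp only [iteratedDeriv_succ']
    exact ih (contDiffAt_uncurry_deriv hF (by simp))

theorem differentiableAt_of_contDiffAt_uncurry {ε : ℝ} {p : P}
    (hF : ContDiffAt ℝ 1 (Function.uncurry F) (ε, p)) : DifferentiableAt ℝ (fun e => F e p) ε :=
  (hF.comp (f := fun e => (e, p)) ε (contDiffAt_id.prodMk contDiffAt_const)).differentiableAt
    one_ne_zero

theorem eventually_forall_contDiffAt_uncurry {n : ℕ} {K : Set P} (hK : IsCompact K)
    (hF : ∀ p ∈ K, ContDiffAt ℝ n (Function.uncurry F) (ε₀, p)) :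
    ∀ᶠ ε in 𝓝 ε₀, ∀ p ∈ K, ContDiffAt ℝ n (Function.uncurry F) (ε, p) :=
  hK.eventually_forall_of_forall_eventually fun p hp => (hF p hp).eventually (by simp)

theorem continuousOn_of_contDiffAt_uncurry {n : WithTop ℕ∞} {K : Set P}
    (hF : ∀ p ∈ K, ContDiffAt ℝ n (Function.uncurry F) (ε₀, p)) : ContinuousOn (F ε₀) K :=
  fun p hp => ((hF p hp).continuousAt.comp (f := fun q => (ε₀, q))
    (by fun_prop)).continuousWithinAt

variable [MeasurableSpace P] [OpensMeasurableSpace P] [SecondCountableTopology P] {μ : Measure P}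
  [IsFiniteMeasureOnCompacts μ] {K : Set P}

theorem hasDerivAt_setIntegral_of_isCompact (hK : IsCompact K)
    (hF : ∀ p ∈ K, ContDiffAt ℝ 1 (Function.uncurry F) (ε₀, p)) :
    HasDerivAt (fun ε => ∫ p in K, F ε p ∂μ) (∫ p in K, deriv (fun e => F e p) ε₀ ∂μ) ε₀ := by
  have hcont : ∀ {ε}, (∀ p ∈ K, ContDiffAt ℝ 1 (Function.uncurry F) (ε, p)) →
      ContinuousOn (F ε) K := continuousOn_of_contDiffAt_uncurry
  have hnear := eventually_forall_contDiffAt_uncurry (n := 1) hK hF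
  have hderiv : ∀ {ε p}, ContDiffAt ℝ 1 (Function.uncurry F) (ε, p) →
      ContDiffAt ℝ 0 (Function.uncurry fun ε p => deriv (fun e => F e p) ε) (ε, p) := fun h =>
    contDiffAt_uncurry_deriv h (by simp)
  obtain ⟨δ, hδ, hball⟩ := Metric.nhds_basis_closedBall.eventually_iff.1 hnear
  obtain ⟨M, hM⟩ := ((isCompact_closedBall ε₀ δ).prod hK).exists_bound_of_continuousOn
    fun z hz => (hderiv (hball hz.1 z.2 hz.2)).continuousAt.continuousWithinAt
  have hmem : ∀ᵐ p ∂μ.restrict K, p ∈ K := ae_restrict_mem hK.measurableSet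
  exact (hasDerivAt_integral_of_dominated_loc_of_deriv_le (bound := fun _ => M)
    (Metric.closedBall_mem_nhds ε₀ hδ)
    (hnear.mono fun ε hε => (hcont hε).aestronglyMeasurable hK.measurableSet)
    ((hcont hF).integrableOn_compact hK)
    ((continuousOn_of_contDiffAt_uncurry fun p hp => hderiv (hF p hp)).aestronglyMeasurable
      hK.measurableSet)
    (hmem.mono fun p hp ε hε => hM (ε, p) ⟨hε, hp⟩)
    (continuousOn_const.integrableOn_compact hK)
    (hmem.mono fun p hp ε hε => (differentiableAt_of_contDiffAt_uncurry
      (hball hε p hp)).hasDerivAt)).2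

theorem iteratedDeriv_setIntegral_of_isCompact (hK : IsCompact K) (n : ℕ)
    (hF : ∀ p ∈ K, ContDiffAt ℝ n (Function.uncurry F) (ε₀, p)) :
    iteratedDeriv n (fun ε => ∫ p in K, F ε p ∂μ) ε₀ =
      ∫ p in K, iteratedDeriv n (fun ε => F ε p) ε₀ ∂μ := by
  induction n generalizing F with
  | zero => simp
  | succ n ih =>
    have hderiv : deriv (fun ε => ∫ p in K, F ε p ∂μ) =ᶠ[𝓝 ε₀]
        fun ε => ∫ p in K, deriv (fun e => F e p) ε ∂μ :=
      (eventually_forall_contDiffAt_uncurry hK hF).mono fun ε hε =>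
        (hasDerivAt_setIntegral_of_isCompact hK fun p hp => (hε p hp).of_le (by simp)).deriv
    rw [iteratedDeriv_succ', hderiv.iteratedDeriv_eq n,
      ih fun p hp => contDiffAt_uncurry_deriv (hF p hp) (by simp)]
    simp only [iteratedDeriv_succ']

end ParametricIntegral

section IteratedIntegral

variable {E : Type*} [NormedAddCommGroup E] [NormedSpace ℝ E] {a b c d : ℝ}

theorem integral_integral_eq_setIntegral_Icc_prod_Icc (hab : a ≤ b) (hcd : c ≤ d) {G : ℝ × ℝ → E}
    (hG : ContinuousOn G (Icc a b ×ˢ Icc c d)) :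
    ∫ s in a..b, ∫ t in c..d, G (s, t) = ∫ p in Icc a b ×ˢ Icc c d, G p := by
  rw [Measure.volume_eq_prod, setIntegral_prod]
  · simp only [intervalIntegral.integral_of_le hab, intervalIntegral.integral_of_le hcd,
      integral_Icc_eq_integral_Ioc]
  · rw [← Measure.volume_eq_prod]
    exact hG.integrableOn_compact (isCompact_Icc.prod isCompact_Icc)

theorem iteratedDeriv_integral_integral (hab : a ≤ b) (hcd : c ≤ d) {F : ℝ → ℝ → ℝ → E} {ε₀ : ℝ}
    (n : ℕ) (hF : ∀ s ∈ Icc a b, ∀ t ∈ Icc c d,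
      ContDiffAt ℝ n (fun z : ℝ × ℝ × ℝ => F z.1 z.2.1 z.2.2) (ε₀, s, t)) :
    iteratedDeriv n (fun ε => ∫ s in a..b, ∫ t in c..d, F ε s t) ε₀ =
      ∫ s in a..b, ∫ t in c..d, iteratedDeriv n (fun ε => F ε s t) ε₀ := by
  let G : ℝ → ℝ × ℝ → E := fun ε p => F ε p.1 p.2
  have hK : IsCompact (Icc a b ×ˢ Icc c d) := isCompact_Icc.prod isCompact_Icc
  have hG : ∀ p ∈ Icc a b ×ˢ Icc c d, ContDiffAt ℝ n (Function.uncurry G) (ε₀, p) :=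
    fun p hp => hF p.1 hp.1 p.2 hp.2
  have hset : (fun ε => ∫ s in a..b, ∫ t in c..d, F ε s t) =ᶠ[𝓝 ε₀]
      fun ε => ∫ p in Icc a b ×ˢ Icc c d, G ε p :=
    (eventually_forall_contDiffAt_uncurry hK hG).mono fun ε hε =>
      integral_integral_eq_setIntegral_Icc_prod_Icc hab hcd
        (continuousOn_of_contDiffAt_uncurry hε)
  rw [hset.iteratedDeriv_eq n, iteratedDeriv_setIntegral_of_isCompact hK n hG]
  exact (integral_integral_eq_setIntegral_Icc_prod_Icc hab hcd (continuousOn_of_contDiffAt_uncurry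
    fun p hp => contDiffAt_uncurry_iteratedDeriv (hG p hp))).symm

theorem integral_integral_add {F G : ℝ → ℝ → E} (hF : Continuous F.uncurry)
    (hG : Continuous G.uncurry) :
    ∫ s in a..b, ∫ t in c..d, (F s t + G s t) =
      (∫ s in a..b, ∫ t in c..d, F s t) + ∫ s in a..b, ∫ t in c..d, G s t := by
  have inner {f : ℝ → ℝ → E} (hf : Continuous f.uncurry) :
      IntervalIntegrable (fun s => ∫ t in c..d, f s t) MeasureTheory.volume a b :=
    (intervalIntegral.continuous_parametric_intervalIntegral_of_continuous'
      hf c d).intervalIntegrable a b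
  have slice {f : ℝ → ℝ → E} (hf : Continuous f.uncurry) (s : ℝ) :
      IntervalIntegrable (f s) MeasureTheory.volume c d :=
    (hf.comp (Continuous.prodMk_right s)).intervalIntegrable c d
  simp only [intervalIntegral.integral_add (slice hF _) (slice hG _),
    intervalIntegral.integral_add (inner hF) (inner hG)]

end IteratedIntegral

section PlaneCurve

/-- The signed curvature of the plane curve `(x, y)` in a unit speed parametrization. -/
def signedCurvature (x y : ℝ → ℝ) (s : ℝ) : ℝ :=
  deriv x s * deriv (deriv y) s - deriv y s * deriv (deriv x) s

/-- The TreadmillSled coordinate `ξ₂ = x sin θ - y cos θ`, where `(x', y') = (cos θ, sin θ)`: the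
component of the position vector along the normal `(y', -x')`. -/
def xi₂ (x y : ℝ → ℝ) (s : ℝ) : ℝ := x s * deriv y s - y s * deriv x s

/-- The area density `√(1 + ω² ξ₁²)` of the helicoidal surface with profile curve `(x, y)`. -/
def helicoidalDensity (ω : ℝ) (x y : ℝ → ℝ) (s : ℝ) : ℝ := √(1 + ω ^ 2 * xi₁ x y s ^ 2)

theorem helicoidalDensity_pos (ω : ℝ) (x y : ℝ → ℝ) (s : ℝ) : 0 < helicoidalDensity ω x y s :=
  Real.sqrt_pos.2 (by positivity)

theorem helicoidalDensity_sq (ω : ℝ) (x y : ℝ → ℝ) (s : ℝ) :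
    helicoidalDensity ω x y s ^ 2 = 1 + ω ^ 2 * xi₁ x y s ^ 2 :=
  Real.sq_sqrt (by positivity)

/-- `(x, y)` is a smooth plane curve, not necessarily closed, parametrized by arc length. -/
structure IsUnitSpeed (x y : ℝ → ℝ) : Prop where
  smooth_x : ContDiff ℝ (⊤ : ℕ∞) x
  smooth_y : ContDiff ℝ (⊤ : ℕ∞) y
  arc_length : ∀ s, deriv x s ^ 2 + deriv y s ^ 2 = 1

variable {x y : ℝ → ℝ}

namespace IsUnitSpeed

variable (hα : IsUnitSpeed x y)
include hα

theorem contDiff_deriv_x : ContDiff ℝ (⊤ : ℕ∞) (deriv x) :=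
  (contDiff_infty_iff_deriv.1 hα.smooth_x).2

theorem contDiff_deriv_y : ContDiff ℝ (⊤ : ℕ∞) (deriv y) :=
  (contDiff_infty_iff_deriv.1 hα.smooth_y).2

theorem contDiff_xi₁ : ContDiff ℝ (⊤ : ℕ∞) (xi₁ x y) :=
  (hα.smooth_x.mul hα.contDiff_deriv_x).add (hα.smooth_y.mul hα.contDiff_deriv_y)

theorem contDiff_xi₂ : ContDiff ℝ (⊤ : ℕ∞) (xi₂ x y) :=
  (hα.smooth_x.mul hα.contDiff_deriv_y).sub (hα.smooth_y.mul hα.contDiff_deriv_x)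

theorem contDiff_signedCurvature : ContDiff ℝ (⊤ : ℕ∞) (signedCurvature x y) :=
  (hα.contDiff_deriv_x.mul (contDiff_infty_iff_deriv.1 hα.contDiff_deriv_y).2).sub
    (hα.contDiff_deriv_y.mul (contDiff_infty_iff_deriv.1 hα.contDiff_deriv_x).2)

theorem contDiff_helicoidalDensity (ω : ℝ) : ContDiff ℝ (⊤ : ℕ∞) (helicoidalDensity ω x y) :=
  (contDiff_const.add (contDiff_const.mul (hα.contDiff_xi₁.pow 2))).sqrt fun s => by positivity

theorem hasDerivAt_x (s : ℝ) : HasDerivAt x (deriv x s) s :=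
  (hα.smooth_x.differentiable (by simp) s).hasDerivAt

theorem hasDerivAt_y (s : ℝ) : HasDerivAt y (deriv y s) s :=
  (hα.smooth_y.differentiable (by simp) s).hasDerivAt

theorem deriv_mul_deriv_deriv_add (s : ℝ) :
    deriv x s * deriv (deriv x) s + deriv y s * deriv (deriv y) s = 0 := by
  have hsum : HasDerivAt (fun u => deriv x u ^ 2 + deriv y u ^ 2) _ s :=
    ((hα.contDiff_deriv_x.differentiable (by simp) s).hasDerivAt.pow 2).add
      ((hα.contDiff_deriv_y.differentiable (by simp) s).hasDerivAt.pow 2)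
  simp only [hα.arc_length] at hsum
  have hzero := hsum.unique (hasDerivAt_const s 1)
  norm_num at hzero
  linarith

theorem hasDerivAt_deriv_x (s : ℝ) :
    HasDerivAt (deriv x) (-(signedCurvature x y s * deriv y s)) s := by
  refine (hα.contDiff_deriv_x.differentiable (by simp) s).hasDerivAt.congr_deriv ?_
  unfold signedCurvature
  linear_combination
    -deriv (deriv x) s * hα.arc_length s + deriv x s * hα.deriv_mul_deriv_deriv_add s

theorem hasDerivAt_deriv_y (s : ℝ) :
    HasDerivAt (deriv y) (signedCurvature x y s * deriv x s) s := by
  refine (hα.contDiff_deriv_y.differentiable (by simp) s).hasDerivAt.congr_deriv ?_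
  unfold signedCurvature
  linear_combination
    -deriv (deriv y) s * hα.arc_length s + deriv y s * hα.deriv_mul_deriv_deriv_add s

theorem hasDerivAt_xi₁ (s : ℝ) :
    HasDerivAt (xi₁ x y) (1 - signedCurvature x y s * xi₂ x y s) s := by
  refine (((hα.hasDerivAt_x s).mul (hα.hasDerivAt_deriv_x s)).add
    ((hα.hasDerivAt_y s).mul (hα.hasDerivAt_deriv_y s))).congr_deriv ?_
  unfold xi₂
  linear_combination hα.arc_length s

theorem hasDerivAt_xi₂ (s : ℝ) :
    HasDerivAt (xi₂ x y) (signedCurvature x y s * xi₁ x y s) s := by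
  refine (((hα.hasDerivAt_x s).mul (hα.hasDerivAt_deriv_y s)).sub
    ((hα.hasDerivAt_y s).mul (hα.hasDerivAt_deriv_x s))).congr_deriv ?_
  unfold xi₁
  ring

theorem hasDerivAt_helicoidalDensity (ω s : ℝ) :
    HasDerivAt (helicoidalDensity ω x y)
      (ω ^ 2 * xi₁ x y s * (1 - signedCurvature x y s * xi₂ x y s) / helicoidalDensity ω x y s)
      s := by
  refine ((((hα.hasDerivAt_xi₁ s).fun_pow 2).const_mul (ω ^ 2)).const_add 1 |>.sqrt
    (by positivity)).congr_deriv ?_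
  simp only [helicoidalDensity]
  field_simp
  norm_num
  ring

theorem deriv_helicoidalDensity (ω s : ℝ) :
    deriv (helicoidalDensity ω x y) s =
      ω ^ 2 * xi₁ x y s * (1 - signedCurvature x y s * xi₂ x y s) / helicoidalDensity ω x y s :=
  (hα.hasDerivAt_helicoidalDensity ω s).deriv

end IsUnitSpeed

namespace IsClosedCurve

variable {ℓ : ℝ} (hα : IsClosedCurve x y ℓ)
include hα

theorem isUnitSpeed : IsUnitSpeed x y := ⟨hα.smooth_x, hα.smooth_y, hα.arc_length⟩

theorem deriv_x_periodic (s : ℝ) : deriv x (s + ℓ) = deriv x s := by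
  rw [← deriv_comp_add_const]
  simp only [hα.periodic_x]

theorem deriv_y_periodic (s : ℝ) : deriv y (s + ℓ) = deriv y s := by
  rw [← deriv_comp_add_const]
  simp only [hα.periodic_y]

theorem xi₁_periodic (s : ℝ) : xi₁ x y (s + ℓ) = xi₁ x y s := by
  simp only [xi₁, hα.periodic_x, hα.periodic_y, hα.deriv_x_periodic, hα.deriv_y_periodic]

theorem xi₂_periodic (s : ℝ) : xi₂ x y (s + ℓ) = xi₂ x y s := by
  simp only [xi₂, hα.periodic_x, hα.periodic_y, hα.deriv_x_periodic, hα.deriv_y_periodic]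

theorem helicoidalDensity_periodic (ω s : ℝ) :
    helicoidalDensity ω x y (s + ℓ) = helicoidalDensity ω x y s := by
  simp only [helicoidalDensity, hα.xi₁_periodic]

end IsClosedCurve

end PlaneCurve

section TwistedFrame

/-- The vector with components `A`, `B` along the tangent `(x', y')` and the normal `(y', -x')` of
the curve `(x, y)` at `s`, both rotated by the angle `-ω t`, and with height `z`. -/
def frameVec (ω : ℝ) (x y : ℝ → ℝ) (s t A B z : ℝ) : Fin 3 → ℝ :=
  ![(A * deriv x s + B * deriv y s) * Real.cos (ω * t) +
      (A * deriv y s - B * deriv x s) * Real.sin (ω * t),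
    -(A * deriv x s + B * deriv y s) * Real.sin (ω * t) +
      (A * deriv y s - B * deriv x s) * Real.cos (ω * t),
    z]

theorem smul_frameVec (r ω : ℝ) (x y : ℝ → ℝ) (s t A B z : ℝ) :
    r • frameVec ω x y s t A B z = frameVec ω x y s t (r * A) (r * B) (r * z) := by
  ext i
  fin_cases i <;> simp [frameVec] <;> ring

theorem contDiff_vec3 {V : Type*} [NormedAddCommGroup V] [NormedSpace ℝ V] {n : WithTop ℕ∞}
    {f g k : V → ℝ} (hf : ContDiff ℝ n f) (hg : ContDiff ℝ n g) (hk : ContDiff ℝ n k) :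
    ContDiff ℝ n fun v => ![f v, g v, k v] :=
  contDiff_pi.2 fun i => by fin_cases i <;> assumption

theorem hasDerivAt_vec3 {f g k : ℝ → ℝ} {f' g' k' r : ℝ} (hf : HasDerivAt f f' r)
    (hg : HasDerivAt g g' r) (hk : HasDerivAt k k' r) :
    HasDerivAt (fun u => ![f u, g u, k u]) ![f', g', k'] r :=
  hasDerivAt_pi.2 fun i => by fin_cases i <;> assumption

theorem hasDerivAt_frameVec_right (ω : ℝ) (x y : ℝ → ℝ) (s : ℝ) {A B z : ℝ → ℝ}
    {A' B' z' t : ℝ} (hA : HasDerivAt A A' t) (hB : HasDerivAt B B' t) (hz : HasDerivAt z z' t) :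
    HasDerivAt (fun u => frameVec ω x y s u (A u) (B u) (z u))
      (frameVec ω x y s t (A' - ω * B t) (B' + ω * A t) z') t := by
  have hθ := (hasDerivAt_id' t).const_mul ω
  have hp := (hA.mul_const (deriv x s)).fun_add (hB.mul_const (deriv y s))
  have hq := (hA.mul_const (deriv y s)).fun_sub (hB.mul_const (deriv x s))
  refine (hasDerivAt_vec3 ((hp.fun_mul hθ.cos).fun_add (hq.fun_mul hθ.sin))
    ((hp.fun_neg.fun_mul hθ.sin).fun_add (hq.fun_mul hθ.cos)) hz).congr_deriv ?_
  ext i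
  fin_cases i <;> simp [frameVec] <;> ring

namespace IsUnitSpeed

variable {x y : ℝ → ℝ} (hα : IsUnitSpeed x y) (ω s t : ℝ)
include hα

theorem hasDerivAt_frameVec_left {A B z : ℝ → ℝ} {A' B' z' s : ℝ} (hA : HasDerivAt A A' s)
    (hB : HasDerivAt B B' s) (hz : HasDerivAt z z' s) :
    HasDerivAt (fun u => frameVec ω x y u t (A u) (B u) (z u))
      (frameVec ω x y s t (A' + signedCurvature x y s * B s) (B' - signedCurvature x y s * A s) z')
      s := by
  have hx := hα.hasDerivAt_deriv_x s
  have hy := hα.hasDerivAt_deriv_y s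
  have hp := (hA.fun_mul hx).fun_add (hB.fun_mul hy)
  have hq := (hA.fun_mul hy).fun_sub (hB.fun_mul hx)
  refine (hasDerivAt_vec3
    ((hp.mul_const (Real.cos (ω * t))).fun_add (hq.mul_const (Real.sin (ω * t))))
    ((hp.fun_neg.mul_const (Real.sin (ω * t))).fun_add (hq.mul_const (Real.cos (ω * t))))
    hz).congr_deriv ?_
  ext i
  fin_cases i <;> simp [frameVec] <;> ring

theorem frameVec_dotProduct (A B z A' B' z' : ℝ) :
    frameVec ω x y s t A B z ⬝ᵥ frameVec ω x y s t A' B' z' = A * A' + B * B' + z * z' := by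
  simp only [frameVec, Matrix.vec3_dotProduct, Matrix.cons_val]
  linear_combination (A * A' + B * B') * hα.arc_length s + (A * A' + B * B') *
    (deriv x s ^ 2 + deriv y s ^ 2) * Real.sin_sq_add_cos_sq (ω * t)

theorem frameVec_cross (A B z A' B' z' : ℝ) :
    frameVec ω x y s t A B z ⨯₃ frameVec ω x y s t A' B' z' =
      frameVec ω x y s t (z * B' - B * z') (A * z' - z * A') (B * A' - A * B') := by
  rw [cross_apply]
  ext i
  fin_cases i
  · simp [frameVec]; ring
  · simp [frameVec]; ring
  · simp only [frameVec, Matrix.cons_val, Fin.reduceFinMk]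
    linear_combination (B * A' - A * B') * hα.arc_length s + (B * A' - A * B') *
      (deriv x s ^ 2 + deriv y s ^ 2) * Real.sin_sq_add_cos_sq (ω * t)

theorem axisDistSq_frameVec (A B z : ℝ) :
    axisDistSq (frameVec ω x y s t A B z) = A ^ 2 + B ^ 2 := by
  simp only [axisDistSq, frameVec, Matrix.cons_val]
  linear_combination (A ^ 2 + B ^ 2) * hα.arc_length s + (A ^ 2 + B ^ 2) *
    (deriv x s ^ 2 + deriv y s ^ 2) * Real.sin_sq_add_cos_sq (ω * t)

theorem fieldW_frameVec (A B z : ℝ) :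
    fieldW (frameVec ω x y s t A B z) =
      frameVec ω x y s t ((A ^ 2 + B ^ 2) / 4 * A) ((A ^ 2 + B ^ 2) / 4 * B) 0 := by
  unfold fieldW
  rw [hα.axisDistSq_frameVec]
  ext i
  fin_cases i <;> simp [frameVec] <;> ring

theorem helicoidal_eq_frameVec :
    helicoidal ω x y s t = frameVec ω x y s t (xi₁ x y s) (xi₂ x y s) t := by
  have hx : xi₁ x y s * deriv x s + xi₂ x y s * deriv y s = x s := by
    unfold xi₁ xi₂
    linear_combination x s * hα.arc_length s
  have hy : xi₁ x y s * deriv y s - xi₂ x y s * deriv x s = y s := by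
    unfold xi₁ xi₂
    linear_combination y s * hα.arc_length s
  rw [helicoidal, frameVec, hx, hy]

end IsUnitSpeed

theorem fieldW₀_frameVec (ω : ℝ) (x y : ℝ → ℝ) (s t A B z : ℝ) :
    fieldW₀ (frameVec ω x y s t A B z) = frameVec ω x y s t (A / 2) (B / 2) 0 := by
  ext i
  fin_cases i <;> simp [fieldW₀, frameVec] <;> ring

end TwistedFrame

section HelicoidalSurface

theorem dotProduct_unitNormal_mul_areaDensity (X : ℝ → ℝ → Fin 3 → ℝ) (s t : ℝ) (v : Fin 3 → ℝ) :
    v ⬝ᵥ unitNormal X s t * areaDensity X s t = v ⬝ᵥ (dS X s t ⨯₃ dT X s t) := by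
  rw [unitNormal, dotProduct_smul, smul_eq_mul]
  by_cases hX : areaDensity X s t = 0
  · have hcross : dS X s t ⨯₃ dT X s t = 0 :=
      dotProduct_self_eq_zero.1
        ((Real.sqrt_eq_zero (Finset.sum_nonneg fun i _ => mul_self_nonneg _)).1 hX)
    simp [hX, hcross]
  · field_simp

/-- The surface obtained by moving each point `helicoidal ω x y s t` horizontally, by the amount
`φ s t` along the normal of the profile curve. -/
def normalGraph (ω : ℝ) (x y : ℝ → ℝ) (φ : ℝ → ℝ → ℝ) (s t : ℝ) : Fin 3 → ℝ :=
  frameVec ω x y s t (xi₁ x y s) (xi₂ x y s + φ s t) t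

theorem dT_normalGraph (ω : ℝ) (x y : ℝ → ℝ) (s t : ℝ) {φ : ℝ → ℝ → ℝ} {φt : ℝ}
    (ht : HasDerivAt (φ s) φt t) :
    dT (normalGraph ω x y φ) s t =
      frameVec ω x y s t (-(ω * (xi₂ x y s + φ s t))) (φt + ω * xi₁ x y s) 1 := by
  refine (hasDerivAt_frameVec_right ω x y s (hasDerivAt_const t (xi₁ x y s))
    (ht.const_add (xi₂ x y s)) (hasDerivAt_id' t)).deriv.trans ?_
  rw [zero_sub]

/-- The mean curvature of the helicoidal surface with profile curve `(x, y)`, as a function of the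
arc length parameter alone. -/
def helicoidalMeanCurvature (ω : ℝ) (x y : ℝ → ℝ) (s : ℝ) : ℝ :=
  (ω ^ 2 * xi₂ x y s - signedCurvature x y s *
      (helicoidalDensity ω x y s ^ 2 + ω ^ 2 * xi₂ x y s ^ 2)) /
    (2 * helicoidalDensity ω x y s ^ 3)

namespace IsUnitSpeed

variable {x y : ℝ → ℝ} (hα : IsUnitSpeed x y) (ω s t : ℝ) {φ : ℝ → ℝ → ℝ} {φs φt : ℝ}
include hα

theorem normalGraph_zero : normalGraph ω x y (fun _ _ => 0) = helicoidal ω x y := by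
  ext1 s
  ext1 t
  rw [normalGraph, add_zero, hα.helicoidal_eq_frameVec]

theorem dS_normalGraph (hs : HasDerivAt (fun u => φ u t) φs s) :
    dS (normalGraph ω x y φ) s t =
      frameVec ω x y s t (1 + signedCurvature x y s * φ s t) φs 0 := by
  refine (hα.hasDerivAt_frameVec_left ω t (hα.hasDerivAt_xi₁ s) ((hα.hasDerivAt_xi₂ s).fun_add hs)
    (hasDerivAt_const s t)).deriv.trans ?_
  congr 1 <;> ring

theorem cross_normalGraph (hs : HasDerivAt (fun u => φ u t) φs s) (ht : HasDerivAt (φ s) φt t) :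
    dS (normalGraph ω x y φ) s t ⨯₃ dT (normalGraph ω x y φ) s t =
      frameVec ω x y s t (-φs) (1 + signedCurvature x y s * φ s t)
        (-((1 + signedCurvature x y s * φ s t) * (φt + ω * xi₁ x y s) +
          φs * (ω * (xi₂ x y s + φ s t)))) := by
  rw [hα.dS_normalGraph ω s t hs, dT_normalGraph ω x y s t ht, hα.frameVec_cross]
  congr 1 <;> ring

theorem dS_helicoidal : dS (helicoidal ω x y) s t = frameVec ω x y s t 1 0 0 := by
  simpa [hα.normalGraph_zero] using
    hα.dS_normalGraph ω s t (φ := fun _ _ => 0) (hasDerivAt_const s 0)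

theorem dT_helicoidal :
    dT (helicoidal ω x y) s t = frameVec ω x y s t (-(ω * xi₂ x y s)) (ω * xi₁ x y s) 1 := by
  simpa [hα.normalGraph_zero] using
    dT_normalGraph ω x y s t (φ := fun _ _ => 0) (hasDerivAt_const t 0)

theorem cross_helicoidal : dS (helicoidal ω x y) s t ⨯₃ dT (helicoidal ω x y) s t =
    frameVec ω x y s t 0 1 (-(ω * xi₁ x y s)) := by
  simpa [hα.normalGraph_zero] using
    hα.cross_normalGraph ω s t (φ := fun _ _ => 0) (hasDerivAt_const s 0) (hasDerivAt_const t 0)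

theorem areaDensity_helicoidal :
    areaDensity (helicoidal ω x y) s t = helicoidalDensity ω x y s := by
  rw [areaDensity, hα.cross_helicoidal, hα.frameVec_dotProduct, helicoidalDensity]
  ring_nf

theorem unitNormal_helicoidal :
    unitNormal (helicoidal ω x y) s t = frameVec ω x y s t 0 (helicoidalDensity ω x y s)⁻¹
      (-(ω * xi₁ x y s / helicoidalDensity ω x y s)) := by
  rw [unitNormal, hα.areaDensity_helicoidal, hα.cross_helicoidal, smul_frameVec]
  congr 1 <;> ring

theorem dS_dS_helicoidal :
    dS (dS (helicoidal ω x y)) s t = frameVec ω x y s t 0 (-signedCurvature x y s) 0 := by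
  rw [funext₂ (hα.dS_helicoidal ω)]
  refine (hα.hasDerivAt_frameVec_left ω t (hasDerivAt_const s 1) (hasDerivAt_const s 0)
    (hasDerivAt_const s 0)).deriv.trans ?_
  congr 1 <;> ring

theorem dS_dT_helicoidal :
    dS (dT (helicoidal ω x y)) s t = frameVec ω x y s t 0 ω 0 := by
  rw [funext₂ (hα.dT_helicoidal ω)]
  refine (hα.hasDerivAt_frameVec_left ω t ((hα.hasDerivAt_xi₂ s).const_mul ω).fun_neg
    ((hα.hasDerivAt_xi₁ s).const_mul ω) (hasDerivAt_const s 1)).deriv.trans ?_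
  congr 1 <;> ring

theorem dT_dT_helicoidal : dT (dT (helicoidal ω x y)) s t =
    frameVec ω x y s t (-(ω ^ 2 * xi₁ x y s)) (-(ω ^ 2 * xi₂ x y s)) 0 := by
  rw [funext₂ (hα.dT_helicoidal ω)]
  refine (hasDerivAt_frameVec_right ω x y s (hasDerivAt_const t _) (hasDerivAt_const t _)
    (hasDerivAt_const t 1)).deriv.trans ?_
  congr 1 <;> ring

theorem meanCurvature_helicoidal :
    meanCurvature (helicoidal ω x y) s t = helicoidalMeanCurvature ω x y s := by
  have hW := (helicoidalDensity_pos ω x y s).ne'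
  have hsq := helicoidalDensity_sq ω x y s
  have hgram : 1 * (ω ^ 2 * xi₂ x y s ^ 2 + helicoidalDensity ω x y s ^ 2) -
      (-(ω * xi₂ x y s)) ^ 2 = helicoidalDensity ω x y s ^ 2 := by ring
  have hE : dS (helicoidal ω x y) s t ⬝ᵥ dS (helicoidal ω x y) s t = 1 := by
    rw [hα.dS_helicoidal, hα.frameVec_dotProduct]
    ring
  have hF : dS (helicoidal ω x y) s t ⬝ᵥ dT (helicoidal ω x y) s t = -(ω * xi₂ x y s) := by
    rw [hα.dS_helicoidal, hα.dT_helicoidal, hα.frameVec_dotProduct]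
    ring
  have hG : dT (helicoidal ω x y) s t ⬝ᵥ dT (helicoidal ω x y) s t =
      ω ^ 2 * xi₂ x y s ^ 2 + helicoidalDensity ω x y s ^ 2 := by
    rw [hα.dT_helicoidal, hα.frameVec_dotProduct, hsq]
    ring
  simp only [meanCurvature, hE, hF, hG, hgram, hα.dS_dS_helicoidal, hα.dS_dT_helicoidal,
    hα.dT_dT_helicoidal, hα.unitNormal_helicoidal, hα.frameVec_dotProduct,
    helicoidalMeanCurvature]
  field_simp
  ring

end IsUnitSpeed

end HelicoidalSurface

section SecondVariation

/-- The integrand of the energy of `normalGraph ω x y φ`, as a function of `s` and of the values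
`f`, `fs`, `ft` of `φ`, `φ_s`, `φ_t` at `(s, t)`. -/
def energyDensity (a Λ₀ ω : ℝ) (x y : ℝ → ℝ) (s f fs ft : ℝ) : ℝ :=
  √((1 + signedCurvature x y s * f) ^ 2 + fs ^ 2 +
      ((1 + signedCurvature x y s * f) * (ft + ω * xi₁ x y s) +
        fs * (ω * (xi₂ x y s + f))) ^ 2) +
    (Λ₀ / 2 - a / 8 * (xi₁ x y s ^ 2 + (xi₂ x y s + f) ^ 2)) *
      ((xi₂ x y s + f) * (1 + signedCurvature x y s * f) - xi₁ x y s * fs)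

/-- The integrand of the second variation of the energy of a helicoidal surface under horizontal
displacements, as a quadratic form in the values `f`, `fs`, `ft` of the displacement and of its
partial derivatives. -/
def secondVariationDensity (a Λ₀ ω : ℝ) (x y : ℝ → ℝ) (s f fs ft : ℝ) : ℝ :=
  ((ft + ω * xi₂ x y s * fs) ^ 2 + helicoidalDensity ω x y s ^ 2 * fs ^ 2) /
      helicoidalDensity ω x y s ^ 3 +
    2 * (ω * xi₁ x y s) * (f * (signedCurvature x y s * ft + ω * fs)) /
      helicoidalDensity ω x y s +
    2 * signedCurvature x y s * f ^ 2 * (Λ₀ / 2 - a / 8 * (xi₁ x y s ^ 2 + xi₂ x y s ^ 2)) -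
    a / 2 * xi₂ x y s * f * (f * (1 + signedCurvature x y s * xi₂ x y s) - xi₁ x y s * fs) -
    a / 4 * xi₂ x y s * f ^ 2

theorem hasDerivAt_quadratic (c₀ c₁ c₂ e : ℝ) :
    HasDerivAt (fun e => c₀ + e * c₁ + e ^ 2 * c₂) (c₁ + 2 * e * c₂) e := by
  refine ((((hasDerivAt_id' e).mul_const c₁).const_add c₀).fun_add
    ((hasDerivAt_pow 2 e).mul_const c₂)).congr_deriv ?_
  norm_num

theorem hasDerivAt_linear (c₁ c₂ e : ℝ) : HasDerivAt (fun e => c₁ + 2 * e * c₂) (2 * c₂) e := by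
  refine ((((hasDerivAt_id' e).const_mul 2).mul_const c₂).const_add c₁).congr_deriv ?_
  ring

theorem iteratedDeriv_two_eq {f f' : ℝ → ℝ} {f'' r : ℝ} (hf : ∀ᶠ e in 𝓝 r, HasDerivAt f (f' e) e)
    (hf' : HasDerivAt f' f'' r) : iteratedDeriv 2 f r = f'' := by
  rw [iteratedDeriv_succ, iteratedDeriv_one,
    EventuallyEq.deriv_eq (hf.mono fun e he => he.deriv), hf'.deriv]

/-- Lagrange's identity collects the terms without second derivatives into the squared norm of the
cross product of `(A, B, C)` and `(A', B', C')`. -/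
theorem iteratedDeriv_two_sqrt_sq_add_sq_add_sq {A B C A' B' C' : ℝ → ℝ} {A'' B'' C'' r : ℝ}
    (hA : ∀ e, HasDerivAt A (A' e) e) (hA' : HasDerivAt A' A'' r)
    (hB : ∀ e, HasDerivAt B (B' e) e) (hB' : HasDerivAt B' B'' r)
    (hC : ∀ e, HasDerivAt C (C' e) e) (hC' : HasDerivAt C' C'' r)
    (hr : 0 < A r ^ 2 + B r ^ 2 + C r ^ 2) :
    iteratedDeriv 2 (fun e => √(A e ^ 2 + B e ^ 2 + C e ^ 2)) r =
      ((A r * B' r - B r * A' r) ^ 2 + (B r * C' r - C r * B' r) ^ 2 +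
          (C r * A' r - A r * C' r) ^ 2) / √(A r ^ 2 + B r ^ 2 + C r ^ 2) ^ 3 +
        (A r * A'' + B r * B'' + C r * C'') / √(A r ^ 2 + B r ^ 2 + C r ^ 2) := by
  have hP (e : ℝ) : HasDerivAt (fun e => A e ^ 2 + B e ^ 2 + C e ^ 2)
      (2 * (A e * A' e + B e * B' e + C e * C' e)) e :=
    ((((hA e).fun_pow 2).fun_add ((hB e).fun_pow 2)).fun_add ((hC e).fun_pow 2)).congr_deriv
      (by norm_num; ring)
  have hP' := ((((hA r).fun_mul hA').fun_add ((hB r).fun_mul hB')).fun_add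
    ((hC r).fun_mul hC')).const_mul 2
  have hsqrt : √(A r ^ 2 + B r ^ 2 + C r ^ 2) ≠ 0 := (Real.sqrt_pos.2 hr).ne'
  have hsq := Real.sq_sqrt hr.le
  refine iteratedDeriv_two_eq
    (((hP r).continuousAt.eventually_ne hr.ne').mono fun e he => (hP e).sqrt he)
    ((hP'.fun_div (((hP r).sqrt hr.ne').const_mul 2) (by positivity)).congr_deriv ?_)
  field_simp
  rw [hsq]
  ring

theorem iteratedDeriv_two_areaTerm (κ ω ξ η f fs ft : ℝ) :
    iteratedDeriv 2 (fun ε => √((1 + κ * (ε * f)) ^ 2 + (ε * fs) ^ 2 +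
        ((1 + κ * (ε * f)) * (ε * ft + ω * ξ) + ε * fs * (ω * (η + ε * f))) ^ 2)) 0 =
      ((ft + ω * η * fs) ^ 2 + (1 + ω ^ 2 * ξ ^ 2) * fs ^ 2) / √(1 + ω ^ 2 * ξ ^ 2) ^ 3 +
        2 * (ω * ξ) * (f * (κ * ft + ω * fs)) / √(1 + ω ^ 2 * ξ ^ 2) := by
  have hA (ε : ℝ) : HasDerivAt (fun ε => 1 + κ * (ε * f)) (κ * f) ε :=
    ((((hasDerivAt_id' ε).mul_const f).const_mul κ).const_add 1).congr_deriv (by ring)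
  have hB (ε : ℝ) : HasDerivAt (fun ε => ε * fs) fs ε := hasDerivAt_mul_const fs
  have hC (ε : ℝ) : HasDerivAt
      (fun ε => (1 + κ * (ε * f)) * (ε * ft + ω * ξ) + ε * fs * (ω * (η + ε * f)))
      (ft + ω * (κ * f * ξ + fs * η) + 2 * ε * (f * (κ * ft + ω * fs))) ε :=
    (hasDerivAt_quadratic (ω * ξ) _ _ ε).congr_of_eventuallyEq (.of_forall fun ε => by ring)
  rw [iteratedDeriv_two_sqrt_sq_add_sq_add_sq hA (hasDerivAt_const 0 _) hB (hasDerivAt_const 0 _)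
    hC (hasDerivAt_linear _ _ 0) (by norm_num; positivity)]
  simp only [zero_mul, mul_zero, add_zero, zero_add, one_mul, one_pow, mul_pow, ne_eq,
    OfNat.ofNat_ne_zero, not_false_eq_true, zero_pow]
  ring

theorem iteratedDeriv_two_potentialTerm (κ ξ η b c f fs : ℝ) :
    iteratedDeriv 2 (fun ε => (b - c * (ξ ^ 2 + (η + ε * f) ^ 2)) *
        ((η + ε * f) * (1 + κ * (ε * f)) - ξ * (ε * fs))) 0 =
      2 * κ * f ^ 2 * (b - c * (ξ ^ 2 + η ^ 2)) -
        4 * c * η * f * (f * (1 + κ * η) - ξ * fs) - 2 * c * η * f ^ 2 := by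
  have hM (ε : ℝ) : HasDerivAt (fun ε => b - c * (ξ ^ 2 + (η + ε * f) ^ 2))
      (-(2 * c * η * f) + 2 * ε * -(c * f ^ 2)) ε :=
    (hasDerivAt_quadratic (b - c * (ξ ^ 2 + η ^ 2)) _ _ ε).congr_of_eventuallyEq
      (.of_forall fun ε => by ring)
  have hN (ε : ℝ) : HasDerivAt (fun ε => (η + ε * f) * (1 + κ * (ε * f)) - ξ * (ε * fs))
      (f * (1 + κ * η) - ξ * fs + 2 * ε * (κ * f ^ 2)) ε :=
    (hasDerivAt_quadratic η _ _ ε).congr_of_eventuallyEq (.of_forall fun ε => by ring)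
  rw [iteratedDeriv_two_eq (.of_forall fun ε => (hM ε).fun_mul (hN ε))
    (((hasDerivAt_linear _ _ 0).fun_mul (hN 0)).fun_add
      ((hM 0).fun_mul (hasDerivAt_linear _ _ 0)))]
  ring

theorem iteratedDeriv_two_energyDensity (a Λ₀ ω : ℝ) (x y : ℝ → ℝ) (s f fs ft : ℝ) :
    iteratedDeriv 2 (fun ε => energyDensity a Λ₀ ω x y s (ε * f) (ε * fs) (ε * ft)) 0 =
      secondVariationDensity a Λ₀ ω x y s f fs ft := by
  simp only [energyDensity]
  rw [iteratedDeriv_fun_add (f := fun ε => √((1 + signedCurvature x y s * (ε * f)) ^ 2 + _ + _))]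
  · rw [iteratedDeriv_two_areaTerm, iteratedDeriv_two_potentialTerm, secondVariationDensity,
      helicoidalDensity, Real.sq_sqrt (by positivity)]
    ring
  · refine ContDiffAt.sqrt (by fun_prop) ?_
    norm_num
    positivity
  · fun_prop

namespace IsUnitSpeed

variable {x y : ℝ → ℝ} (hα : IsUnitSpeed x y)
include hα

theorem contDiffAt_energyDensity (a Λ₀ ω s ft : ℝ) :
    ContDiffAt ℝ (⊤ : ℕ∞)
      (fun z : ℝ × ℝ × ℝ × ℝ => energyDensity a Λ₀ ω x y z.1 z.2.1 z.2.2.1 z.2.2.2)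
      (s, 0, 0, ft) := by
  have hκ := hα.contDiff_signedCurvature
  have hξ := hα.contDiff_xi₁
  have hη := hα.contDiff_xi₂
  unfold energyDensity
  refine ContDiffAt.add (ContDiffAt.sqrt (by fun_prop) ?_) (by fun_prop)
  norm_num
  positivity

theorem energy_normalGraph {a Λ₀ ℓ h ω : ℝ} {φ φs φt : ℝ → ℝ → ℝ}
    (hφs : ∀ s t, HasDerivAt (fun u => φ u t) (φs s t) s)
    (hφt : ∀ s t, HasDerivAt (φ s) (φt s t) t)
    (cφ : Continuous φ.uncurry) (cφs : Continuous φs.uncurry) (cφt : Continuous φt.uncurry) :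
    energy a Λ₀ ℓ h (normalGraph ω x y φ) = ∫ s in (0 : ℝ)..ℓ, ∫ t in (-(h / 2))..(h / 2),
      energyDensity a Λ₀ ω x y s (φ s t) (φs s t) (φt s t) := by
  have hκ := hα.contDiff_signedCurvature.continuous
  have hξ := hα.contDiff_xi₁.continuous
  have hη := hα.contDiff_xi₂.continuous
  unfold Function.uncurry at cφ cφs cφt
  simp only [energy, surfaceArea, volume, inertia, surfaceIntegral,
    dotProduct_unitNormal_mul_areaDensity, one_mul]
  simp only [areaDensity, hα.cross_normalGraph ω _ _ (hφs _ _) (hφt _ _)]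
  simp only [normalGraph, hα.fieldW_frameVec, fieldW₀_frameVec, hα.frameVec_dotProduct]
  rw [sub_eq_add_neg, ← neg_mul]
  simp only [← intervalIntegral.integral_const_mul]
  rw [← integral_integral_add, ← integral_integral_add]
  · congr! 4 with s t
    unfold energyDensity
    ring_nf
  all_goals unfold Function.uncurry; fun_prop

theorem iteratedDeriv_two_energy_normalGraph {a Λ₀ ℓ h ω : ℝ} (hℓ : 0 ≤ ℓ) (hh : 0 ≤ h)
    {u us ut : ℝ → ℝ → ℝ} (hus : ∀ s t, HasDerivAt (fun r => u r t) (us s t) s)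
    (hut : ∀ s t, HasDerivAt (u s) (ut s t) t) (cu : ContDiff ℝ 2 u.uncurry)
    (cus : ContDiff ℝ 2 us.uncurry) (cut : ContDiff ℝ 2 ut.uncurry) :
    iteratedDeriv 2 (fun ε => energy a Λ₀ ℓ h (normalGraph ω x y fun s t => ε * u s t)) 0 =
      ∫ s in (0 : ℝ)..ℓ, ∫ t in (-(h / 2))..(h / 2),
        secondVariationDensity a Λ₀ ω x y s (u s t) (us s t) (ut s t) := by
  have henergy (ε : ℝ) := hα.energy_normalGraph (a := a) (Λ₀ := Λ₀) (ℓ := ℓ) (h := h) (ω := ω)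
    (fun s t => (hus s t).const_mul ε) (fun s t => (hut s t).const_mul ε)
    (continuous_const.mul cu.continuous) (continuous_const.mul cus.continuous)
    (continuous_const.mul cut.continuous)
  simp only [henergy]
  rw [iteratedDeriv_integral_integral hℓ (by linarith) 2]
  · simp only [iteratedDeriv_two_energyDensity]
  · intro s _ t _
    unfold Function.uncurry at cu cus cut
    have hjet : ContDiffAt ℝ 2 (fun z : ℝ × ℝ × ℝ => (z.2.1, z.1 * u z.2.1 z.2.2,
        z.1 * us z.2.1 z.2.2, z.1 * ut z.2.1 z.2.2)) (0, s, t) := by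
      fun_prop
    have hdensity : ContDiffAt ℝ 2
        (fun z : ℝ × ℝ × ℝ × ℝ => energyDensity a Λ₀ ω x y z.1 z.2.1 z.2.2.1 z.2.2.2)
        (s, 0 * u s t, 0 * us s t, 0 * ut s t) := by
      simp only [zero_mul]
      exact (hα.contDiffAt_energyDensity a Λ₀ ω s 0).of_le ENat.LEInfty.out
    exact hdensity.comp (0, s, t) hjet

end IsUnitSpeed

end SecondVariation

section ProductVariation

/-- The variation of `helicoidal ω x y` which moves the points horizontally along the normal of the
profile curve, with speed `f s * g t`. -/
def productVariation (ω : ℝ) (x y f g : ℝ → ℝ) (ε : ℝ) : ℝ → ℝ → Fin 3 → ℝ :=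
  normalGraph ω x y fun s t => ε * (f s * g t)

theorem secondVariationDensity_mul (a Λ₀ ω : ℝ) (x y : ℝ → ℝ) (s f f' g g' : ℝ) :
    secondVariationDensity a Λ₀ ω x y s (f * g) (f' * g) (f * g') =
      f ^ 2 / helicoidalDensity ω x y s ^ 3 * g' ^ 2 +
        2 * ω * (xi₂ x y s * f * f' / helicoidalDensity ω x y s ^ 3 +
          xi₁ x y s * signedCurvature x y s * f ^ 2 / helicoidalDensity ω x y s) * (g * g') +
        secondVariationDensity a Λ₀ ω x y s f f' 0 * g ^ 2 := by
  unfold secondVariationDensity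
  ring

theorem integral_mul_deriv_self_eq_zero {g : ℝ → ℝ} (hg : ContDiff ℝ 1 g) {b c : ℝ}
    (hb : g b = 0) (hc : g c = 0) : ∫ t in b..c, g t * deriv g t = 0 := by
  have hg' (t : ℝ) : HasDerivAt (fun t => g t ^ 2 / 2) (g t * deriv g t) t :=
    (((hg.differentiable_one t).hasDerivAt.fun_pow 2).div_const 2).congr_deriv (by norm_num; ring)
  rw [intervalIntegral.integral_eq_sub_of_hasDerivAt (fun t _ => hg' t)
    ((hg.continuous.mul hg.continuous_deriv_one).intervalIntegrable _ _)]
  norm_num [hb, hc]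

theorem integral_secondVariationDensity_mul (a Λ₀ ω : ℝ) (x y : ℝ → ℝ) (s f f' : ℝ) {g : ℝ → ℝ}
    (hg : ContDiff ℝ 1 g) {b c : ℝ} (hb : g b = 0) (hc : g c = 0) :
    ∫ t in b..c, secondVariationDensity a Λ₀ ω x y s (f * g t) (f' * g t) (f * deriv g t) =
      f ^ 2 / helicoidalDensity ω x y s ^ 3 * (∫ t in b..c, deriv g t ^ 2) +
        secondVariationDensity a Λ₀ ω x y s f f' 0 * ∫ t in b..c, g t ^ 2 := by
  have cg := hg.continuous
  simp only [secondVariationDensity_mul]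
  rw [intervalIntegral.integral_add (Continuous.intervalIntegrable (by fun_prop) _ _)
      (Continuous.intervalIntegrable (by fun_prop) _ _),
    intervalIntegral.integral_add (Continuous.intervalIntegrable (by fun_prop) _ _)
      (Continuous.intervalIntegrable (by fun_prop) _ _)]
  simp only [intervalIntegral.integral_const_mul, integral_mul_deriv_self_eq_zero hg hb hc,
    mul_zero, add_zero]

namespace IsUnitSpeed

variable {x y : ℝ → ℝ} (hα : IsUnitSpeed x y)
include hα

theorem continuous_secondVariationDensity {a Λ₀ ω : ℝ} {f f' : ℝ → ℝ} (hf : Continuous f)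
    (hf' : Continuous f') :
    Continuous fun s => secondVariationDensity a Λ₀ ω x y s (f s) (f' s) 0 := by
  have hκ := hα.contDiff_signedCurvature.continuous
  have hξ := hα.contDiff_xi₁.continuous
  have hη := hα.contDiff_xi₂.continuous
  have hW := (hα.contDiff_helicoidalDensity ω).continuous
  have hW₀ (s : ℝ) := (helicoidalDensity_pos ω x y s).ne'
  unfold secondVariationDensity
  fun_prop (disch := simp [hW₀])

theorem iteratedDeriv_two_energy_productVariation {a Λ₀ ω ℓ h : ℝ} {f g : ℝ → ℝ} (hℓ : 0 ≤ ℓ)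
    (hh : 0 ≤ h) (hf : ContDiff ℝ 3 f) (hg : ContDiff ℝ 3 g) (hbot : g (-(h / 2)) = 0)
    (htop : g (h / 2) = 0) :
    iteratedDeriv 2 (fun ε => energy a Λ₀ ℓ h (productVariation ω x y f g ε)) 0 =
      (∫ s in (0 : ℝ)..ℓ, f s ^ 2 / helicoidalDensity ω x y s ^ 3) *
          (∫ t in (-(h / 2))..(h / 2), deriv g t ^ 2) +
        (∫ s in (0 : ℝ)..ℓ, secondVariationDensity a Λ₀ ω x y s (f s) (deriv f s) 0) *
          ∫ t in (-(h / 2))..(h / 2), g t ^ 2 := by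
  have hf' : ContDiff ℝ 2 (deriv f) := ((contDiff_succ_iff_deriv (n := 2)).1 hf).2.2
  have hf₂ : ContDiff ℝ 2 f := hf.of_le (by norm_num)
  have hg₂ : ContDiff ℝ 2 g := hg.of_le (by norm_num)
  have cf := hf.continuous
  have cW := (hα.contDiff_helicoidalDensity ω).continuous
  have hW₀ (s : ℝ) := (helicoidalDensity_pos ω x y s).ne'
  unfold productVariation
  rw [hα.iteratedDeriv_two_energy_normalGraph hℓ hh
    (fun s t => (hf.differentiable (by norm_num) s).hasDerivAt.mul_const (g t))
    (fun s t => (hg.differentiable (by norm_num) t).hasDerivAt.const_mul (f s))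
    (by unfold Function.uncurry; fun_prop) (by unfold Function.uncurry; fun_prop)
    (by unfold Function.uncurry; fun_prop)]
  simp only [integral_secondVariationDensity_mul a Λ₀ ω x y _ _ _ (hg.of_le (by norm_num)) hbot
    htop]
  rw [intervalIntegral.integral_add, intervalIntegral.integral_mul_const,
    intervalIntegral.integral_mul_const]
  · exact Continuous.intervalIntegrable (by fun_prop (disch := simp [hW₀])) _ _
  · exact ((hα.continuous_secondVariationDensity cf hf'.continuous).mul_const _).intervalIntegrable
      _ _

theorem normalComponent_productVariation (ω : ℝ) (f g : ℝ → ℝ) (s t : ℝ) :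
    normalComponent (helicoidal ω x y) (productVariation ω x y f g) s t =
      f s * g t / helicoidalDensity ω x y s := by
  have hvar : HasDerivAt (fun ε => productVariation ω x y f g ε s t)
      (frameVec ω x y s t 0 (f s * g t) 0) 0 := by
    have haffine (ε : ℝ) : productVariation ω x y f g ε s t =
        frameVec ω x y s t (xi₁ x y s) (xi₂ x y s) t + ε • frameVec ω x y s t 0 (f s * g t) 0 := by
      ext i
      fin_cases i <;> simp [productVariation, normalGraph, frameVec] <;> ring
    simp only [haffine]
    exact (((hasDerivAt_id' (0 : ℝ)).smul_const _).const_add _).congr_deriv (one_smul _ _)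
  rw [normalComponent, hvar.deriv, hα.unitNormal_helicoidal, hα.frameVec_dotProduct]
  ring

theorem surfaceIntegral_normalComponent_productVariation (ω ℓ h : ℝ) (f g : ℝ → ℝ) :
    surfaceIntegral ℓ h (helicoidal ω x y)
        (normalComponent (helicoidal ω x y) (productVariation ω x y f g)) =
      (∫ s in (0 : ℝ)..ℓ, f s) * ∫ t in (-(h / 2))..(h / 2), g t := by
  have hW₀ (s : ℝ) := (helicoidalDensity_pos ω x y s).ne'
  simp only [surfaceIntegral, hα.normalComponent_productVariation, hα.areaDensity_helicoidal,
    div_mul_cancel₀ _ (hW₀ _), intervalIntegral.integral_const_mul,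
    intervalIntegral.integral_mul_const]

end IsUnitSpeed

theorem IsClosedCurve.isVariation_productVariation {x y f g : ℝ → ℝ} {ℓ h : ℝ}
    (hα : IsClosedCurve x y ℓ) (ω : ℝ) (hf : ContDiff ℝ (⊤ : ℕ∞) f) (hfper : ∀ s, f (s + ℓ) = f s)
    (hg : ContDiff ℝ (⊤ : ℕ∞) g) (hbot : g (-(h / 2)) = 0) (htop : g (h / 2) = 0) :
    IsVariation ℓ h (helicoidal ω x y) (productVariation ω x y f g) where
  smooth := by
    have hx' := hα.isUnitSpeed.contDiff_deriv_x
    have hy' := hα.isUnitSpeed.contDiff_deriv_y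
    have hξ := hα.isUnitSpeed.contDiff_xi₁
    have hη := hα.isUnitSpeed.contDiff_xi₂
    exact contDiff_vec3 (by fun_prop) (by fun_prop) (by fun_prop)
  periodic ε s t := by
    simp only [productVariation, normalGraph, frameVec, hα.xi₁_periodic, hα.xi₂_periodic,
      hα.deriv_x_periodic, hα.deriv_y_periodic, hfper]
  start s t _ := by
    simp only [productVariation, zero_mul, hα.isUnitSpeed.normalGraph_zero]
  fixed_bot ε s := by
    simp only [productVariation, normalGraph, hbot, mul_zero, add_zero,
      hα.isUnitSpeed.helicoidal_eq_frameVec]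
  fixed_top ε s := by
    simp only [productVariation, normalGraph, htop, mul_zero, add_zero,
      hα.isUnitSpeed.helicoidal_eq_frameVec]

end ProductVariation

section Equilibrium

variable {x y : ℝ → ℝ} {a Λ₀ ω : ℝ}

namespace IsUnitSpeed

variable (hα : IsUnitSpeed x y)
include hα

theorem hasDerivAt_mul_div_helicoidalDensity (ω s : ℝ) :
    HasDerivAt (fun s => ω ^ 2 * (xi₁ x y s * xi₂ x y s) / helicoidalDensity ω x y s)
      (2 * helicoidalMeanCurvature ω x y s + signedCurvature x y s * helicoidalDensity ω x y s)
      s := by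
  have hW := (helicoidalDensity_pos ω x y s).ne'
  refine ((((hα.hasDerivAt_xi₁ s).fun_mul (hα.hasDerivAt_xi₂ s)).const_mul (ω ^ 2)).fun_div
    (hα.hasDerivAt_helicoidalDensity ω s) hW).congr_deriv ?_
  unfold helicoidalMeanCurvature
  field_simp
  linear_combination (ω ^ 2 * xi₂ x y s * (1 - signedCurvature x y s * xi₂ x y s) -
    signedCurvature x y s * helicoidalDensity ω x y s ^ 2) * helicoidalDensity_sq ω x y s

theorem hasDerivAt_mul_sub_inv_helicoidalDensity (ω s : ℝ) :
    HasDerivAt (fun s => ω ^ 2 * (xi₁ x y s *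
        (helicoidalDensity ω x y s - (helicoidalDensity ω x y s)⁻¹)))
      (deriv (helicoidalDensity ω x y) s ^ 2 *
          (helicoidalDensity ω x y s ^ 2 + ω ^ 2 * xi₂ x y s ^ 2) / helicoidalDensity ω x y s ^ 3 +
        2 * ω ^ 2 * xi₁ x y s * deriv (helicoidalDensity ω x y) s -
        ω ^ 2 * (xi₁ x y s * xi₂ x y s) * (2 * helicoidalMeanCurvature ω x y s) *
          deriv (helicoidalDensity ω x y) s / helicoidalDensity ω x y s) s := by
  have hW := (helicoidalDensity_pos ω x y s).ne'
  have hdW := hα.hasDerivAt_helicoidalDensity ω s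
  refine (((hα.hasDerivAt_xi₁ s).fun_mul (hdW.fun_sub (hdW.fun_inv hW))).const_mul
    (ω ^ 2)).congr_deriv ?_
  rw [hα.deriv_helicoidalDensity]
  unfold helicoidalMeanCurvature
  field_simp
  linear_combination (ω ^ 2 * (1 - signedCurvature x y s * xi₂ x y s) *
    helicoidalDensity ω x y s ^ 4) * helicoidalDensity_sq ω x y s

theorem two_mul_helicoidalMeanCurvature (heq : IsEquilibrium a Λ₀ (helicoidal ω x y)) (s : ℝ) :
    2 * helicoidalMeanCurvature ω x y s = Λ₀ - a / 2 * (xi₁ x y s ^ 2 + xi₂ x y s ^ 2) := by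
  have h₀ := heq s 0
  rwa [hα.meanCurvature_helicoidal, hα.helicoidal_eq_frameVec, hα.axisDistSq_frameVec] at h₀

theorem hasDerivAt_two_mul_helicoidalMeanCurvature (heq : IsEquilibrium a Λ₀ (helicoidal ω x y))
    (s : ℝ) :
    HasDerivAt (fun s => 2 * helicoidalMeanCurvature ω x y s) (-(a * xi₁ x y s)) s := by
  simp only [hα.two_mul_helicoidalMeanCurvature heq]
  refine (((((hα.hasDerivAt_xi₁ s).fun_pow 2).fun_add ((hα.hasDerivAt_xi₂ s).fun_pow 2)).const_mul
    (a / 2)).const_sub Λ₀).congr_deriv ?_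
  norm_num
  ring

theorem hasDerivAt_secondVariationPrimitive (heq : IsEquilibrium a Λ₀ (helicoidal ω x y))
    (s : ℝ) :
    HasDerivAt (fun s => ω ^ 2 * (xi₁ x y s *
          (helicoidalDensity ω x y s - (helicoidalDensity ω x y s)⁻¹)) +
        ω ^ 2 * (xi₁ x y s * xi₂ x y s) / helicoidalDensity ω x y s *
          (helicoidalDensity ω x y s * (2 * helicoidalMeanCurvature ω x y s)) +
        a / 4 * (xi₁ x y s * xi₂ x y s * helicoidalDensity ω x y s ^ 2))
      (secondVariationDensity a Λ₀ ω x y s (helicoidalDensity ω x y s)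
          (deriv (helicoidalDensity ω x y) s) 0 +
        2 * (2 * helicoidalMeanCurvature ω x y s ^ 2 * helicoidalDensity ω x y s) +
        a * xi₂ x y s) s := by
  have hW := (helicoidalDensity_pos ω x y s).ne'
  have hΛ₀ : Λ₀ = 2 * helicoidalMeanCurvature ω x y s +
      a / 2 * (xi₁ x y s ^ 2 + xi₂ x y s ^ 2) := by
    linarith [hα.two_mul_helicoidalMeanCurvature heq s]
  have hdW := hα.hasDerivAt_helicoidalDensity ω s
  rw [← hα.deriv_helicoidalDensity] at hdW
  refine (((hα.hasDerivAt_mul_sub_inv_helicoidalDensity ω s).fun_add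
    ((hα.hasDerivAt_mul_div_helicoidalDensity ω s).fun_mul
      (hdW.fun_mul (hα.hasDerivAt_two_mul_helicoidalMeanCurvature heq s)))).fun_add
    ((((hα.hasDerivAt_xi₁ s).fun_mul (hα.hasDerivAt_xi₂ s)).fun_mul
      (hdW.fun_pow 2)).const_mul (a / 4))).congr_deriv ?_
  rw [secondVariationDensity, hΛ₀]
  simp only [Nat.cast_ofNat, Nat.add_one_sub_one, pow_one]
  field_simp
  linear_combination (64 * a * xi₂ x y s * helicoidalDensity ω x y s ^ 3) *
    helicoidalDensity_sq ω x y s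

theorem continuous_helicoidalMeanCurvature (ω : ℝ) :
    Continuous (helicoidalMeanCurvature ω x y) := by
  have hκ := hα.contDiff_signedCurvature.continuous
  have hη := hα.contDiff_xi₂.continuous
  have hW := (hα.contDiff_helicoidalDensity ω).continuous
  have hW₀ (s : ℝ) := (helicoidalDensity_pos ω x y s).ne'
  unfold helicoidalMeanCurvature
  fun_prop (disch := simp [hW₀])

end IsUnitSpeed

namespace IsClosedCurve

variable {ℓ h : ℝ} (hα : IsClosedCurve x y ℓ)
include hα

theorem integral_secondVariationDensity_helicoidalDensity
    (heq : IsEquilibrium a Λ₀ (helicoidal ω x y)) :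
    ∫ s in (0 : ℝ)..ℓ, secondVariationDensity a Λ₀ ω x y s (helicoidalDensity ω x y s)
        (deriv (helicoidalDensity ω x y) s) 0 =
      -2 * ((∫ s in (0 : ℝ)..ℓ,
          2 * helicoidalMeanCurvature ω x y s ^ 2 * helicoidalDensity ω x y s) +
        a * enclosedArea x y ℓ) := by
  have cη := hα.isUnitSpeed.contDiff_xi₂.continuous
  have cH := hα.isUnitSpeed.continuous_helicoidalMeanCurvature ω
  have hW := hα.isUnitSpeed.contDiff_helicoidalDensity ω
  have cW := hW.continuous
  have cq := hα.isUnitSpeed.continuous_secondVariationDensity (a := a) (Λ₀ := Λ₀) (ω := ω) cW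
    (hW.continuous_deriv (by simp))
  have hξ := hα.xi₁_periodic 0
  have hη := hα.xi₂_periodic 0
  have hdensity := hα.helicoidalDensity_periodic ω 0
  rw [zero_add] at hξ hη hdensity
  have hcurvature : helicoidalMeanCurvature ω x y ℓ = helicoidalMeanCurvature ω x y 0 := by
    have hℓ := hα.isUnitSpeed.two_mul_helicoidalMeanCurvature heq ℓ
    rw [hξ, hη, ← hα.isUnitSpeed.two_mul_helicoidalMeanCurvature heq 0] at hℓ
    linarith
  have hprimitive := intervalIntegral.integral_eq_sub_of_hasDerivAt (a := 0) (b := ℓ)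
    (fun s _ => hα.isUnitSpeed.hasDerivAt_secondVariationPrimitive heq s)
    (Continuous.intervalIntegrable (by fun_prop) _ _)
  rw [hξ, hη, hdensity, hcurvature, sub_self,
    intervalIntegral.integral_add (Continuous.intervalIntegrable (by fun_prop) _ _)
      (Continuous.intervalIntegrable (by fun_prop) _ _),
    intervalIntegral.integral_add (cq.intervalIntegrable _ _)
      (Continuous.intervalIntegrable (by fun_prop) _ _),
    intervalIntegral.integral_const_mul, intervalIntegral.integral_const_mul] at hprimitive
  have harea : ∫ s in (0 : ℝ)..ℓ, xi₂ x y s = 2 * enclosedArea x y ℓ := by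
    simp only [xi₂, enclosedArea]
    ring
  rw [harea] at hprimitive
  linear_combination hprimitive

theorem secondVariation_nonneg_of_isStable (hh : 0 ≤ h)
    (heq : IsEquilibrium a Λ₀ (helicoidal ω x y))
    (hstable : IsStable a Λ₀ ℓ h (helicoidal ω x y)) {g : ℝ → ℝ} (hg : ContDiff ℝ (⊤ : ℕ∞) g)
    (hbot : g (-(h / 2)) = 0) (htop : g (h / 2) = 0)
    (hmean : ∫ t in (-(h / 2))..(h / 2), g t = 0) :
    0 ≤ (∫ s in (0 : ℝ)..ℓ, 1 / helicoidalDensity ω x y s) *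
          (∫ t in (-(h / 2))..(h / 2), deriv g t ^ 2) -
        2 * ((∫ s in (0 : ℝ)..ℓ,
            2 * helicoidalMeanCurvature ω x y s ^ 2 * helicoidalDensity ω x y s) +
          a * enclosedArea x y ℓ) * ∫ t in (-(h / 2))..(h / 2), g t ^ 2 := by
  have hW := hα.isUnitSpeed.contDiff_helicoidalDensity ω
  have hinv (s : ℝ) : helicoidalDensity ω x y s ^ 2 / helicoidalDensity ω x y s ^ 3 =
      1 / helicoidalDensity ω x y s := by
    have := (helicoidalDensity_pos ω x y s).ne'
    field_simp
  have hvar := hstable _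
    (hα.isVariation_productVariation ω hW (hα.helicoidalDensity_periodic ω) hg hbot htop) (by
      rw [hα.isUnitSpeed.surfaceIntegral_normalComponent_productVariation, hmean, mul_zero])
  rw [hα.isUnitSpeed.iteratedDeriv_two_energy_productVariation hα.length_pos.le hh
    (hW.of_le ENat.LEInfty.out) (hg.of_le ENat.LEInfty.out) hbot htop,
    hα.integral_secondVariationDensity_helicoidalDensity heq] at hvar
  simp only [hinv] at hvar
  linarith

end IsClosedCurve

end Equilibrium

section Trigonometric

variable {k b : ℝ} (hkb : k * b = Real.pi)
include hkb

theorem integral_sin_mul_eq_zero : ∫ t in (-b)..b, Real.sin (k * t) = 0 := by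
  have hk : k ≠ 0 := left_ne_zero_of_mul (hkb.trans_ne Real.pi_ne_zero)
  rw [intervalIntegral.integral_comp_mul_left _ hk]
  simp [hkb]

theorem integral_sin_mul_sq : ∫ t in (-b)..b, Real.sin (k * t) ^ 2 = b := by
  have hk : k ≠ 0 := left_ne_zero_of_mul (hkb.trans_ne Real.pi_ne_zero)
  rw [intervalIntegral.integral_comp_mul_left (fun u => Real.sin u ^ 2) hk, integral_sin_sq]
  simp only [mul_neg, hkb, Real.sin_neg, Real.sin_pi, smul_eq_mul]
  rw [← hkb]
  field_simp
  ring

theorem integral_cos_mul_sq : ∫ t in (-b)..b, Real.cos (k * t) ^ 2 = b := by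
  have hk : k ≠ 0 := left_ne_zero_of_mul (hkb.trans_ne Real.pi_ne_zero)
  rw [intervalIntegral.integral_comp_mul_left (fun u => Real.cos u ^ 2) hk, integral_cos_sq]
  simp only [mul_neg, hkb, Real.sin_neg, Real.sin_pi, smul_eq_mul]
  rw [← hkb]
  field_simp
  ring

end Trigonometric

section HeightBound

theorem IsClosedCurve.areaBound_of_isStable {x y : ℝ → ℝ} {a Λ₀ ω ℓ h : ℝ}
    (hα : IsClosedCurve x y ℓ) (hh : 0 < h) (heq : IsEquilibrium a Λ₀ (helicoidal ω x y))
    (hstable : IsStable a Λ₀ ℓ h (helicoidal ω x y)) : AreaBound a ω ℓ h x y := by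
  have hkh : 2 * Real.pi / h * (h / 2) = Real.pi := by field_simp
  have hderiv (t : ℝ) : deriv (fun t => Real.sin (2 * Real.pi / h * t)) t =
      2 * Real.pi / h * Real.cos (2 * Real.pi / h * t) := by
    rw [((hasDerivAt_id' t).const_mul (2 * Real.pi / h)).sin.deriv, mul_one, mul_comm]
  have hnonneg := hα.secondVariation_nonneg_of_isStable hh.le heq hstable
    (g := fun t => Real.sin (2 * Real.pi / h * t)) (by fun_prop) (by simp [hkh]) (by simp [hkh])
    (integral_sin_mul_eq_zero hkh)
  simp only [hderiv, mul_pow, intervalIntegral.integral_const_mul, integral_sin_mul_sq hkh,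
    integral_cos_mul_sq hkh, helicoidalDensity] at hnonneg
  simp only [AreaBound, hα.isUnitSpeed.meanCurvature_helicoidal, ge_iff_le]
  rw [← sub_nonneg, ← mul_nonneg_iff_of_pos_right hh]
  exact hnonneg.trans_eq (by ring)

namespace IsUnitSpeed

variable {x y : ℝ → ℝ} (hα : IsUnitSpeed x y)
include hα

theorem surfaceIntegral_helicoidal (ω ℓ h : ℝ) (u : ℝ → ℝ) :
    surfaceIntegral ℓ h (helicoidal ω x y) (fun s _ => u s) =
      h * ∫ s in (0 : ℝ)..ℓ, u s * helicoidalDensity ω x y s := by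
  simp only [surfaceIntegral, hα.areaDensity_helicoidal, intervalIntegral.integral_const,
    smul_eq_mul, sub_neg_eq_add, add_halves, mul_left_comm _ h,
    intervalIntegral.integral_const_mul]

theorem volume_helicoidal (ω ℓ h : ℝ) :
    volume ℓ h (helicoidal ω x y) = h * enclosedArea x y ℓ := by
  have hflux (s t : ℝ) : fieldW₀ (helicoidal ω x y s t) ⬝ᵥ
      (dS (helicoidal ω x y) s t ⨯₃ dT (helicoidal ω x y) s t) = 1 / 2 * xi₂ x y s := by
    rw [hα.cross_helicoidal, hα.helicoidal_eq_frameVec, fieldW₀_frameVec, hα.frameVec_dotProduct]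
    ring
  simp only [volume, surfaceIntegral, dotProduct_unitNormal_mul_areaDensity, hflux,
    intervalIntegral.integral_const, smul_eq_mul, sub_neg_eq_add, add_halves,
    intervalIntegral.integral_const_mul, enclosedArea, xi₂]
  ring

theorem areaBound_iff_volumeBound {ℓ h : ℝ} (a ω : ℝ) (hh : 0 < h) :
    AreaBound a ω ℓ h x y ↔ VolumeBound a ω ℓ h x y := by
  simp only [AreaBound, VolumeBound, hα.meanCurvature_helicoidal, hα.surfaceIntegral_helicoidal,
    hα.volume_helicoidal, ge_iff_le]
  rw [← mul_le_mul_iff_right₀ hh]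
  unfold helicoidalDensity
  field_simp

end IsUnitSpeed

end HeightBound

end HelicoidalDrop

end

theorem mainTheorem5 (a Λ₀ ω ℓ h : ℝ) (x y : ℝ → ℝ) (hh : 0 < h)
    (hα : IsClosedCurve x y ℓ)
    (heq : IsEquilibrium a Λ₀ (helicoidal ω x y)) :
    (IsStable a Λ₀ ℓ h (helicoidal ω x y) → AreaBound a ω ℓ h x y) ∧
    (AreaBound a ω ℓ h x y ↔ VolumeBound a ω ℓ h x y) :=
  ⟨hα.areaBound_of_isStable hh heq, hα.isUnitSpeed.areaBound_iff_volumeBound a ω hh⟩
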